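/- Let $R$ be a commutative ring with unity and let $C$ be a semidualizing $R$-module, that is: $C$ has a projective resolution by finitely generated projective modules, the homothety map $R\to\operatorname{Hom}_R(C,C)$ is an isomorphism, and $\operatorname{Ext}^i_R(C,C)=0$ for all $i\ge 1$. An $R$-module $M$ is called $G_C$-projective if there is an exact sequence of $R$-modules $$\mathbb X=\cdots\to P_1\to P_0\to C\otimes_R P_{-1}\to C\otimes_R P_{-2}\to\cdots$$ with all $P_i$ projective, such that $M\cong\operatorname{im}(P_0\to C\otimes_R P_{-1})$ and $\operatorname{Hom}_R(\mathbb X,C\otimes_R P)$ is exact for every projective $R$-module $P$. For an $R$-module $T$, let $\operatorname{add}_R T$ be the class of modules isomorphic to direct summands of finite direct sums of copies of $T$. Let $\operatorname{gen}^*(T)$ be the class of modules $N$ for which there is an exact sequence $\cdots\to T_1\to T_0\to N\to 0$ with all $T_i\in\operatorname{add}_R T$ that stays exact under $\operatorname{Hom}_R(T,-)$; dually, let $\operatorname{cogen}^*(T)$ be the class of modules $N$ for which there is an exact sequence $0\to N\to T^0\to T^1\to\cdots$ with all $T^i\in\operatorname{add}_R T$ that stays exact under $\operatorname{Hom}_R(-,T)$.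 **Lemma.** Let $M$ be a finitely generated $G_C$-projective $R$-module. Then: 1. $M\in\operatorname{cogen}^*(C)$. Moreover, there are integers $\alpha_0,\alpha_1,\ldots\ge 0$ and an exact sequence $0\to M\to C^{\alpha_0}\to C^{\alpha_1}\to\cdots$ that stays exact under $\operatorname{Hom}_R(-,C)$. 2. $M^C:=\operatorname{Hom}_R(M,C)\in\operatorname{gen}^*(R)$. -/

import Mathlib

open scoped TensorProduct

universe u

namespace RelGorenstein

section

variable {R : Type u} [CommRing R]

/-- The sequence `Hom(B'', N) → Hom(B, N) → Hom(B', N)` obtained from `B' → B → B''` by applying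
`Hom(-, N)` is exact at `Hom(B, N)`. -/
def ContraHomExact (N : Type u) [AddCommGroup N] [Module R N]
    {B' B B'' : Type u} [AddCommGroup B'] [Module R B'] [AddCommGroup B] [Module R B]
    [AddCommGroup B''] [Module R B''] (f : B' →ₗ[R] B) (g : B →ₗ[R] B'') : Prop :=
  Function.Exact (fun φ : B'' →ₗ[R] N => φ.comp g) (fun φ : B →ₗ[R] N => φ.comp f)

/-- The sequence `Hom(N, B') → Hom(N, B) → Hom(N, B'')` obtained from `B' → B → B''` by applying
`Hom(N, -)` is exact at `Hom(N, B)`. -/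
def CovHomExact (N : Type u) [AddCommGroup N] [Module R N]
    {B' B B'' : Type u} [AddCommGroup B'] [Module R B'] [AddCommGroup B] [Module R B]
    [AddCommGroup B''] [Module R B''] (f : B' →ₗ[R] B) (g : B →ₗ[R] B'') : Prop :=
  Function.Exact (fun φ : N →ₗ[R] B' => f.comp φ) (fun φ : N →ₗ[R] B => g.comp φ)

/-- An exact sequence `⋯ → X₁ → X₀ → M → 0`. -/
structure Resolution (R : Type u) [CommRing R] (M : Type u) [AddCommGroup M] [Module R M] where
  X : ℕ → ModuleCat.{u} R
  d : ∀ n, X (n + 1) →ₗ[R] X n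
  aug : X 0 →ₗ[R] M
  exact : ∀ n, Function.Exact (d (n + 1)) (d n)
  exact_aug : Function.Exact (d 0) aug
  surjective_aug : Function.Surjective aug

/-- `Hom(T, -)` leaves the augmented sequence `⋯ → X₁ → X₀ → M → 0` exact. -/
structure Resolution.HomExact {M : Type u} [AddCommGroup M] [Module R M] (S : Resolution R M)
    (T : Type u) [AddCommGroup T] [Module R T] : Prop where
  exact : ∀ n, CovHomExact T (S.d (n + 1)) (S.d n)
  exact_aug : CovHomExact T (S.d 0) S.aug
  surjective_aug : Function.Surjective (fun φ : T →ₗ[R] S.X 0 => S.aug.comp φ)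

/-- An exact sequence `0 → M → X⁰ → X¹ → ⋯`. -/
structure Coresolution (R : Type u) [CommRing R] (M : Type u) [AddCommGroup M] [Module R M] where
  X : ℕ → ModuleCat.{u} R
  d : ∀ n, X n →ₗ[R] X (n + 1)
  coaug : M →ₗ[R] X 0
  injective_coaug : Function.Injective coaug
  exact_coaug : Function.Exact coaug (d 0)
  exact : ∀ n, Function.Exact (d n) (d (n + 1))

/-- `Hom(-, T)` leaves the augmented sequence `0 → M → X⁰ → X¹ → ⋯` exact. -/
structure Coresolution.HomExact {M : Type u} [AddCommGroup M] [Module R M] (S : Coresolution R M)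
    (T : Type u) [AddCommGroup T] [Module R T] : Prop where
  surjective_coaug : Function.Surjective (fun φ : S.X 0 →ₗ[R] T => φ.comp S.coaug)
  exact_coaug : ContraHomExact T S.coaug (S.d 0)
  exact : ∀ n, ContraHomExact T (S.d n) (S.d (n + 1))

/-- `X` lies in `add T`: it is isomorphic to a direct summand of a finite direct sum of copies
of `T`. -/
def IsInAdd (R : Type u) [CommRing R] (T : Type u) [AddCommGroup T] [Module R T]
    (X : Type u) [AddCommGroup X] [Module R X] : Prop :=
  ∃ (n : ℕ) (p q : Submodule R (Fin n → T)), IsCompl p q ∧ Nonempty (X ≃ₗ[R] p)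

/-- `M` lies in `gen*(T)`. -/
def IsInGenStar (R : Type u) [CommRing R] (T : Type u) [AddCommGroup T] [Module R T]
    (M : Type u) [AddCommGroup M] [Module R M] : Prop :=
  ∃ S : Resolution R M, (∀ n, IsInAdd R T (S.X n)) ∧ S.HomExact T

/-- `M` lies in `cogen*(T)`. -/
def IsInCogenStar (R : Type u) [CommRing R] (T : Type u) [AddCommGroup T] [Module R T]
    (M : Type u) [AddCommGroup M] [Module R M] : Prop :=
  ∃ S : Coresolution R M, (∀ n, IsInAdd R T (S.X n)) ∧ S.HomExact T

/-- `C` is a semidualizing `R`-module. -/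
structure IsSemidualizing (R : Type u) [CommRing R] (C : Type u) [AddCommGroup C] [Module R C] :
    Prop where
  /-- `C` has a projective resolution by finitely generated projective modules. -/
  resolution : ∃ S : Resolution R C, ∀ n, Module.Finite R (S.X n) ∧ Module.Projective R (S.X n)
  /-- The homothety map `R → Hom(C, C)`, `r ↦ (c ↦ r • c)`, is an isomorphism. -/
  homothety : Function.Bijective (LinearMap.lsmul R C)
  /-- `Extⁱ(C, C) = 0` for `i ≥ 1`. -/
  ext_eq_zero : ∀ i : ℕ, 1 ≤ i →
    Subsingleton (CategoryTheory.Abelian.Ext (ModuleCat.of R C) (ModuleCat.of R C) i)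

/-- An exact sequence `⋯ → P₁ → P₀ → C ⊗ Q₀ → C ⊗ Q₁ → ⋯` with all `Pₙ`, `Qₙ` projective
(`Qₙ` is the module with index `-(n + 1)`) which stays exact under `Hom(-, C ⊗ P)` for every
projective module `P`. -/
structure CompleteResolution (R : Type u) [CommRing R] (C : Type u) [AddCommGroup C]
    [Module R C] where
  P : ℕ → ModuleCat.{u} R
  Q : ℕ → ModuleCat.{u} R
  projective_P : ∀ n, Module.Projective R (P n)
  projective_Q : ∀ n, Module.Projective R (Q n)
  dP : ∀ n, P (n + 1) →ₗ[R] P n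
  mid : P 0 →ₗ[R] C ⊗[R] Q 0
  dQ : ∀ n, C ⊗[R] Q n →ₗ[R] C ⊗[R] Q (n + 1)
  exact_P : ∀ n, Function.Exact (dP (n + 1)) (dP n)
  exact_P_mid : Function.Exact (dP 0) mid
  exact_mid_Q : Function.Exact mid (dQ 0)
  exact_Q : ∀ n, Function.Exact (dQ n) (dQ (n + 1))
  homExact_P : ∀ (L : Type u) [AddCommGroup L] [Module R L] [Module.Projective R L] (n : ℕ),
    ContraHomExact (C ⊗[R] L) (dP (n + 1)) (dP n)
  homExact_P_mid : ∀ (L : Type u) [AddCommGroup L] [Module R L] [Module.Projective R L],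
    ContraHomExact (C ⊗[R] L) (dP 0) mid
  homExact_mid_Q : ∀ (L : Type u) [AddCommGroup L] [Module R L] [Module.Projective R L],
    ContraHomExact (C ⊗[R] L) mid (dQ 0)
  homExact_Q : ∀ (L : Type u) [AddCommGroup L] [Module R L] [Module.Projective R L] (n : ℕ),
    ContraHomExact (C ⊗[R] L) (dQ n) (dQ (n + 1))

/-- `M` is `G_C`-projective. -/
def IsGCProjective (R : Type u) [CommRing R] (C : Type u) [AddCommGroup C] [Module R C]
    (M : Type u) [AddCommGroup M] [Module R M] : Prop :=
  ∃ X : CompleteResolution R C, Nonempty (M ≃ₗ[R] LinearMap.range X.mid)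

end

end RelGorenstein

/-!
The terms `T` of a coresolution of `M` by modules of the form `C ⊗ P`, with `P` projective, are
replaced by finite powers of `C`, one at a time. Since `M` is finitely generated, its embedding
into `T` factors as `M → Cⁿ → T`, and every map from `M` to a module `C ⊗ P` extends to `Cⁿ`
because it extends to `T`. Two embeddings of `M` which extend along each other have stably
isomorphic cokernels (dual Schanuel lemma), so `Cⁿ / M` and `T / M` agree up to summands `C ⊗ P`.
As `Cⁿ / M` is again finitely generated, the process continues. Applying `Hom(-, C)` to the result
and using `Hom(C, C) ≅ R`, one resolves `Hom(M, C)` by finite free modules.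
-/

namespace RelGorenstein

section Schanuel

variable {R X T Y D N : Type*} [Ring R] [AddCommGroup X] [Module R X] [AddCommGroup T] [Module R T]
  [AddCommGroup Y] [Module R Y] [AddCommGroup D] [Module R D] [AddCommGroup N] [Module R N]

theorem nonempty_prod_linearEquiv_of_comp_eq {i : X →ₗ[R] T} {p : T →ₗ[R] Y} {j : X →ₗ[R] D}
    {q : D →ₗ[R] N} (hip : Function.Exact i p) (hp : Function.Surjective p)
    (hjq : Function.Exact j q) (hq : Function.Surjective q) {a : T →ₗ[R] D} (ha : a ∘ₗ i = j)
    {b : D →ₗ[R] T} (hb : b ∘ₗ j = i) : Nonempty ((N × T) ≃ₗ[R] (Y × D)) := by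
  -- `(t, d) ↦ (d + a t, t - b (d + a t))` is an automorphism carrying `i X × 0` onto `j X × 0`.
  let s : (T × D) →ₗ[R] D := a.coprod LinearMap.id
  let f : (T × D) →ₗ[R] (N × T) := (q ∘ₗ s).prod (LinearMap.fst R T D - b ∘ₗ s)
  let g : (T × D) →ₗ[R] (Y × D) := p.prodMap LinearMap.id
  have ha' (x) : a (i x) = j x := LinearMap.congr_fun ha x
  have hb' (x) : b (j x) = i x := LinearMap.congr_fun hb x
  have hf : Function.Surjective f := by
    rintro ⟨n, t⟩
    obtain ⟨d, rfl⟩ := hq n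
    exact ⟨(t + b d, d - a (t + b d)), by simp [f, s]⟩
  have hg : Function.Surjective g := hp.prodMap Function.surjective_id
  have hker : LinearMap.ker f = LinearMap.ker g := by
    ext ⟨t, d⟩
    constructor
    · intro h
      obtain ⟨hqs, hts⟩ : q (a t + d) = 0 ∧ t - b (a t + d) = 0 := by simpa [f, s] using h
      obtain ⟨x, hx⟩ := (hjq _).1 hqs
      obtain rfl : t = i x := by rw [sub_eq_zero.1 hts, ← hx, hb']
      obtain rfl : d = 0 := by simpa [ha'] using hx
      simp [g, hip.apply_apply_eq_zero]
    · intro h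
      obtain ⟨hpt, rfl⟩ : p t = 0 ∧ d = 0 := by simpa [g] using h
      obtain ⟨x, rfl⟩ := (hip t).1 hpt
      simp [f, s, ha', hb', hjq.apply_apply_eq_zero]
  exact ⟨(f.quotKerEquivOfSurjective hf).symm ≪≫ₗ Submodule.quotEquivOfEq _ _ hker ≪≫ₗ
    g.quotKerEquivOfSurjective hg⟩

end Schanuel

section HomExact

variable {R : Type u} [CommRing R] {A B D E N : Type u} [AddCommGroup A] [Module R A]
  [AddCommGroup B] [Module R B] [AddCommGroup D] [Module R D] [AddCommGroup E] [Module R E]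
  [AddCommGroup N] [Module R N]

theorem contraHomExact_comp_iff {s : E →ₗ[R] A} (hs : Function.Surjective s) {f : A →ₗ[R] B}
    {g : B →ₗ[R] D} : ContraHomExact N (f ∘ₗ s) g ↔ ContraHomExact N f g :=
  Function.Injective.comp_exact_iff_exact (f := LinearMap.lcomp R N g) (g := LinearMap.lcomp R N f)
    (LinearMap.lcomp_injective_of_surjective s hs)

theorem contraHomExact_comp_of_surjective_lcomp {f : A →ₗ[R] B} {g : B →ₗ[R] D}
    (hfg : Function.Exact f g) (hg : Function.Surjective g) {k : D →ₗ[R] E}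
    (hk : Function.Surjective (LinearMap.lcomp R N k)) : ContraHomExact N f (k ∘ₗ g) :=
  (Function.Surjective.comp_exact_iff_exact (f := LinearMap.lcomp R N g)
    (g := LinearMap.lcomp R N f) hk).2 (LinearMap.exact_lcomp_of_exact_of_surjective N hfg hg)

theorem ContraHomExact.surjective_lcomp_subtype_range {f : A →ₗ[R] B} {g : B →ₗ[R] D}
    (h : ContraHomExact N f g) (hgf : g ∘ₗ f = 0) :
    Function.Surjective (LinearMap.lcomp R N (LinearMap.range g).subtype) := by
  intro φ
  have hf : g.rangeRestrict ∘ₗ f = 0 :=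
    LinearMap.ext fun x => Subtype.ext (LinearMap.congr_fun hgf x)
  have hφ : (φ ∘ₗ g.rangeRestrict) ∘ₗ f = 0 := by
    rw [LinearMap.comp_assoc, hf, LinearMap.comp_zero]
  obtain ⟨ψ, hψ⟩ := (h (φ ∘ₗ g.rangeRestrict)).1 hφ
  refine ⟨ψ, LinearMap.ext ?_⟩
  rintro ⟨_, b, rfl⟩
  exact LinearMap.congr_fun hψ b

theorem covHomExact_of_projective [Module.Projective R N] {f : A →ₗ[R] B} {g : B →ₗ[R] D}
    (hfg : Function.Exact f g) : CovHomExact N f g := by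
  intro φ
  constructor
  · intro h
    obtain ⟨ψ, hψ⟩ := Module.projective_lifting_property f.rangeRestrict
      (φ.codRestrict (LinearMap.range f) fun x => (hfg (φ x)).1 (LinearMap.congr_fun h x))
      f.surjective_rangeRestrict
    exact ⟨ψ, LinearMap.ext fun x => congrArg Subtype.val (LinearMap.congr_fun hψ x)⟩
  · rintro ⟨ψ, rfl⟩
    exact LinearMap.ext fun x => hfg.apply_apply_eq_zero (ψ x)

end HomExact

section CProjective

/-- The class `𝒫_C` of `C`-projective modules: those isomorphic to `C ⊗ P` for a projective
module `P`. -/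
def IsCProjective (R : Type u) [CommRing R] (C : Type u) [AddCommGroup C] [Module R C]
    (T : Type u) [AddCommGroup T] [Module R T] : Prop :=
  ∃ P : ModuleCat.{u} R, Module.Projective R P ∧ Nonempty (T ≃ₗ[R] C ⊗[R] P)

variable {R : Type u} [CommRing R] {C T T' : Type u} [AddCommGroup C] [Module R C]
  [AddCommGroup T] [Module R T] [AddCommGroup T'] [Module R T']

theorem isCProjective_tensorProduct (P : Type u) [AddCommGroup P] [Module R P]
    [Module.Projective R P] : IsCProjective R C (C ⊗[R] P) :=
  ⟨ModuleCat.of R P, ‹_›, ⟨LinearEquiv.refl R _⟩⟩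

theorem isCProjective_self : IsCProjective R C C :=
  ⟨ModuleCat.of R R, Module.Projective.of_free, ⟨(TensorProduct.rid R C).symm⟩⟩

theorem isCProjective_pi (n : ℕ) : IsCProjective R C (Fin n → C) :=
  ⟨ModuleCat.of R (Fin n → R), Module.Projective.of_free,
    ⟨(TensorProduct.piScalarRight R R C (Fin n)).symm⟩⟩

theorem IsCProjective.prod (hT : IsCProjective R C T) (hT' : IsCProjective R C T') :
    IsCProjective R C (T × T') := by
  obtain ⟨P, hP, ⟨e⟩⟩ := hT
  obtain ⟨P', hP', ⟨e'⟩⟩ := hT'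
  exact ⟨ModuleCat.of R (P × P'), inferInstanceAs (Module.Projective R (P × P')),
    ⟨e.prodCongr e' ≪≫ₗ (TensorProduct.prodRight R R C P P').symm⟩⟩

end CProjective

section FiniteFactorization

variable {R C X : Type*} [CommRing R] [AddCommGroup C] [Module R C] [AddCommGroup X] [Module R X]

theorem exists_finset_le_supported {J : Type*} {N : Submodule R (J →₀ C)} (hN : N.FG) :
    ∃ s : Finset J, N ≤ Finsupp.supported C R (s : Set J) := by
  classical
  obtain ⟨G, rfl⟩ := hN
  refine ⟨G.biUnion Finsupp.support, Submodule.span_le.2 fun x hx => ?_⟩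
  exact (Finsupp.mem_supported R x).2 (Finset.subset_biUnion_of_mem Finsupp.support hx)

theorem exists_pi_factorization_finsupp [Module.Finite R X] {J : Type*} (f : X →ₗ[R] (J →₀ C)) :
    ∃ (n : ℕ) (j : X →ₗ[R] (Fin n → C)) (r : (Fin n → C) →ₗ[R] (J →₀ C)), r ∘ₗ j = f := by
  obtain ⟨s, hs⟩ := exists_finset_le_supported (Module.Finite.fg_top.map f)
  let e : Finsupp.supported C R (s : Set J) ≃ₗ[R] (Fin s.card → C) :=
    Finsupp.supportedEquivFinsupp (s : Set J) ≪≫ₗ Finsupp.linearEquivFunOnFinite R C s ≪≫ₗ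
      LinearEquiv.funCongrLeft R C s.equivFin.symm
  refine ⟨s.card, e.toLinearMap ∘ₗ f.codRestrict _ fun x => hs ⟨x, trivial, rfl⟩,
    Submodule.subtype _ ∘ₗ e.symm.toLinearMap, ?_⟩
  ext1 x
  simp only [LinearMap.comp_apply, LinearEquiv.coe_coe, LinearEquiv.symm_apply_apply,
    Submodule.subtype_apply, LinearMap.codRestrict_apply]

theorem exists_pi_factorization_tensorProduct [Module.Finite R X] {P : Type*} [AddCommGroup P]
    [Module R P] [Module.Projective R P] (f : X →ₗ[R] C ⊗[R] P) :
    ∃ (n : ℕ) (j : X →ₗ[R] (Fin n → C)) (r : (Fin n → C) →ₗ[R] C ⊗[R] P), r ∘ₗ j = f := by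
  classical
  obtain ⟨s, hs⟩ := Module.projective_def'.1 ‹Module.Projective R P›
  let e := TensorProduct.finsuppScalarRight R R C P
  obtain ⟨n, j, r, h⟩ := exists_pi_factorization_finsupp (e.toLinearMap ∘ₗ s.lTensor C ∘ₗ f)
  refine ⟨n, j, (Finsupp.linearCombination R id).lTensor C ∘ₗ e.symm.toLinearMap ∘ₗ r, ?_⟩
  ext1 x
  have hx : r (j x) = e (s.lTensor C (f x)) := LinearMap.congr_fun h x
  simp only [LinearMap.comp_apply, LinearEquiv.coe_coe, hx, LinearEquiv.symm_apply_apply]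
  rw [← LinearMap.lTensor_comp_apply, hs, LinearMap.lTensor_id_apply]

theorem IsCProjective.exists_pi_factorization {R C M T : Type u} [CommRing R] [AddCommGroup C]
    [Module R C] [AddCommGroup M] [Module R M] [AddCommGroup T] [Module R T]
    [Module.Finite R M] (hT : IsCProjective R C T) (f : M →ₗ[R] T) :
    ∃ (n : ℕ) (j : M →ₗ[R] (Fin n → C)) (r : (Fin n → C) →ₗ[R] T), r ∘ₗ j = f := by
  obtain ⟨P, hP, ⟨e⟩⟩ := hT
  obtain ⟨n, j, r, h⟩ := exists_pi_factorization_tensorProduct (e.toLinearMap ∘ₗ f)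
  exact ⟨n, j, e.symm.toLinearMap ∘ₗ r, by rw [LinearMap.comp_assoc, h]; ext; simp⟩

end FiniteFactorization

section ProperCoresolution

variable {R : Type u} [CommRing R] {C M : Type u} [AddCommGroup C] [Module R C]
  [AddCommGroup M] [Module R M]

/-- A proper `𝒫_C`-coresolution: its terms are `C`-projective, and `Hom(-, C ⊗ P)` leaves it exact
for all projective `P`. -/
structure Coresolution.IsProper (S : Coresolution R M) (C : Type u) [AddCommGroup C]
    [Module R C] : Prop where
  isCProjective : ∀ n, IsCProjective R C (S.X n)
  homExact : ∀ (P : Type u) [AddCommGroup P] [Module R P] [Module.Projective R P],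
    S.HomExact (C ⊗[R] P)

theorem Coresolution.IsProper.surjective_lcomp_coaug {S : Coresolution R M} (hS : S.IsProper C)
    {L : Type u} [AddCommGroup L] [Module R L] (hL : IsCProjective R C L) :
    Function.Surjective (LinearMap.lcomp R L S.coaug) := by
  obtain ⟨P, hP, ⟨e⟩⟩ := hL
  intro φ
  obtain ⟨ψ, hψ⟩ := (hS.homExact P).surjective_coaug (e.toLinearMap ∘ₗ φ)
  exact ⟨e.symm.toLinearMap ∘ₗ ψ, LinearMap.ext fun x =>
    e.symm_apply_eq.2 (LinearMap.congr_fun hψ x)⟩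

/-- The coresolution of the image of `f` given by an exact sequence `A → X⁰ → X¹ → ⋯` whose first
map is `f`. -/
def Coresolution.ofRange {A : Type u} [AddCommGroup A] [Module R A] (X : ℕ → ModuleCat.{u} R)
    (d : ∀ n, X n →ₗ[R] X (n + 1)) (f : A →ₗ[R] X 0) (hf : Function.Exact f (d 0))
    (hd : ∀ n, Function.Exact (d n) (d (n + 1))) : Coresolution R (LinearMap.range f) where
  X := X
  d := d
  coaug := (LinearMap.range f).subtype
  injective_coaug := Submodule.injective_subtype _
  exact_coaug := by rwa [← Function.Surjective.comp_exact_iff_exact f.surjective_rangeRestrict]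
  exact := hd

theorem Coresolution.homExact_ofRange {A B N : Type u} [AddCommGroup A] [Module R A]
    [AddCommGroup B] [Module R B] [AddCommGroup N] [Module R N] {X : ℕ → ModuleCat.{u} R}
    {d : ∀ n, X n →ₗ[R] X (n + 1)} {f : A →ₗ[R] X 0} (hf : Function.Exact f (d 0))
    (hd : ∀ n, Function.Exact (d n) (d (n + 1))) {g : B →ₗ[R] A} (hfg : f ∘ₗ g = 0)
    (hNg : ContraHomExact N g f) (hNf : ContraHomExact N f (d 0))
    (hNd : ∀ n, ContraHomExact N (d n) (d (n + 1))) :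
    (Coresolution.ofRange X d f hf hd).HomExact N where
  surjective_coaug := hNg.surjective_lcomp_subtype_range hfg
  exact_coaug := (contraHomExact_comp_iff f.surjective_rangeRestrict).1 hNf
  exact := hNd

/-- The coresolution `0 → Z → X¹ → X² → ⋯` of the first cosyzygy `Z` of `M`. -/
def Coresolution.tail (S : Coresolution R M) : Coresolution R (LinearMap.range (S.d 0)) :=
  .ofRange (fun n => S.X (n + 1)) (fun n => S.d (n + 1)) (S.d 0) (S.exact 0)
    fun n => S.exact (n + 1)

theorem Coresolution.IsProper.tail {S : Coresolution R M} (hS : S.IsProper C) :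
    S.tail.IsProper C where
  isCProjective n := hS.isCProjective (n + 1)
  homExact P _ _ _ :=
    have h := hS.homExact P
    Coresolution.homExact_ofRange _ _ S.exact_coaug.linearMap_comp_eq_zero h.exact_coaug (h.exact 0)
      fun n => h.exact (n + 1)

/-- Up to adding `C`-projective summands, `M` is isomorphic to a module with a proper
`𝒫_C`-coresolution. -/
def IsStablyCoresolved (R : Type u) [CommRing R] (C : Type u) [AddCommGroup C] [Module R C]
    (M : Type u) [AddCommGroup M] [Module R M] : Prop :=
  ∃ (T U Z : ModuleCat.{u} R) (S : Coresolution R Z), IsCProjective R C T ∧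
    IsCProjective R C U ∧ S.IsProper C ∧ Nonempty ((M × T) ≃ₗ[R] (Z × U))

theorem IsGCProjective.isStablyCoresolved (hM : IsGCProjective R C M) :
    IsStablyCoresolved R C M := by
  obtain ⟨X, ⟨e⟩⟩ := hM
  have := X.projective_Q
  let S : Coresolution R (LinearMap.range X.mid) :=
    .ofRange (fun n => ModuleCat.of R (C ⊗[R] X.Q n)) X.dQ X.mid X.exact_mid_Q X.exact_Q
  have hS : S.IsProper C :=
    { isCProjective := fun n => isCProjective_tensorProduct (X.Q n)
      homExact := fun P _ _ _ => Coresolution.homExact_ofRange _ _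
        X.exact_P_mid.linearMap_comp_eq_zero
        (X.homExact_P_mid P) (X.homExact_mid_Q P) (X.homExact_Q P) }
  exact ⟨.of R (Fin 0 → C), .of R (Fin 0 → C), .of R (LinearMap.range X.mid), S,
    isCProjective_pi 0, isCProjective_pi 0, hS, ⟨e.prodCongr (LinearEquiv.refl R _)⟩⟩

end ProperCoresolution

section FiniteCoresolution

variable {R : Type u} [CommRing R] {C M : Type u} [AddCommGroup C] [Module R C]
  [AddCommGroup M] [Module R M]

theorem IsStablyCoresolved.exists_embedding (hM : IsStablyCoresolved R C M) :
    ∃ (T V Y : ModuleCat.{u} R) (i : (M × T) →ₗ[R] V) (p : V →ₗ[R] Y) (S : Coresolution R Y),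
      IsCProjective R C T ∧ IsCProjective R C V ∧ S.IsProper C ∧ Function.Injective i ∧
      Function.Exact i p ∧ Function.Surjective p ∧
      ∀ (L : Type u) [AddCommGroup L] [Module R L], IsCProjective R C L →
        Function.Surjective (LinearMap.lcomp R L i) := by
  obtain ⟨T, U, Z, S, hT, hU, hS, ⟨e⟩⟩ := hM
  let ι : (Z × U) →ₗ[R] (S.X 0 × U) := S.coaug.prodMap LinearMap.id
  let p : (S.X 0 × U) →ₗ[R] LinearMap.range (S.d 0) :=
    (S.d 0).rangeRestrict ∘ₗ LinearMap.fst R (S.X 0) U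
  have hι : Function.Injective ι := S.injective_coaug.prodMap Function.injective_id
  have hιp : Function.Exact ι p := by
    rintro ⟨x, u⟩
    simp [ι, p, Subtype.ext_iff, S.exact_coaug x]
  have hp : Function.Surjective p :=
    (S.d 0).surjective_rangeRestrict.comp LinearMap.fst_surjective
  have hext (L : Type u) [AddCommGroup L] [Module R L] (hL : IsCProjective R C L) :
      Function.Surjective (LinearMap.lcomp R L ι) := by
    intro φ
    obtain ⟨ψ, hψ⟩ := hS.surjective_lcomp_coaug hL (φ ∘ₗ LinearMap.inl R Z U)
    refine ⟨ψ.coprod (φ ∘ₗ LinearMap.inr R Z U), LinearMap.prod_ext ?_ ?_⟩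
    · rw [← hψ]
      ext
      simp [ι, Prod.mk_zero_zero]
    · ext
      simp [ι]
  refine ⟨T, .of R (S.X 0 × U), .of R (LinearMap.range (S.d 0)), ι ∘ₗ e.toLinearMap, p, S.tail,
    hT, (hS.isCProjective 0).prod hU, hS.tail, hι.comp e.injective,
    e.surjective.comp_exact_iff_exact.2 hιp, hp, fun L _ _ hL => ?_⟩
  exact (e.congrLeft L R).symm.surjective.comp (hext L hL)

theorem IsStablyCoresolved.exists_embedding_pi [Module.Finite R M]
    (hM : IsStablyCoresolved R C M) :
    ∃ (n : ℕ) (j : M →ₗ[R] (Fin n → C)), Function.Injective j ∧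
      Function.Surjective (LinearMap.lcomp R C j) ∧
      IsStablyCoresolved R C ((Fin n → C) ⧸ LinearMap.range j) := by
  obtain ⟨T, V, Y, i, p, S, hT, hV, hS, hi, hip, hp, hext⟩ := hM.exists_embedding
  obtain ⟨n, j, r, hrj⟩ := hV.exists_pi_factorization (i ∘ₗ LinearMap.inl R M T)
  have hrj' (x : M) : r (j x) = i (x, 0) := LinearMap.congr_fun hrj x
  have hD : IsCProjective R C ((Fin n → C) × T) := (isCProjective_pi n).prod hT
  -- `M × T` embeds into `V` and into `Cⁿ × T`, and each embedding extends along the other.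
  let j' : (M × T) →ₗ[R] ((Fin n → C) × T) := j.prodMap LinearMap.id
  let q : ((Fin n → C) × T) →ₗ[R] ((Fin n → C) ⧸ LinearMap.range j) :=
    (LinearMap.range j).mkQ ∘ₗ LinearMap.fst R (Fin n → C) T
  have hjq : Function.Exact j' q := by
    rintro ⟨x, t⟩
    simp [j', q]
  have hq : Function.Surjective q :=
    (LinearMap.range j).mkQ_surjective.comp LinearMap.fst_surjective
  obtain ⟨a, ha⟩ : ∃ a : V →ₗ[R] ((Fin n → C) × T), a ∘ₗ i = j' := hext _ hD j'
  have hb : r.coprod (i ∘ₗ LinearMap.inr R M T) ∘ₗ j' = i := by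
    ext x <;> simp [j', hrj', Prod.mk_zero_zero]
  refine ⟨n, j, ?_, fun φ => ?_, V, .of R ((Fin n → C) × T), Y, S, hV, hD, hS,
    nonempty_prod_linearEquiv_of_comp_eq hip hp hjq hq ha hb⟩
  · refine Function.Injective.of_comp (f := r) ?_
    rw [← LinearMap.coe_comp, hrj]
    exact hi.comp LinearMap.inl_injective
  · obtain ⟨ψ, hψ⟩ := hext C isCProjective_self (φ ∘ₗ LinearMap.fst R M T)
    refine ⟨ψ ∘ₗ r, LinearMap.ext fun x => ?_⟩
    have hx : ψ (i (x, 0)) = φ x := LinearMap.congr_fun hψ (x, 0)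
    simpa [hrj'] using hx

theorem exists_coresolution_of_exists_embedding {T : Type u} [AddCommGroup T] [Module R T]
    {𝒯 𝒴 : ModuleCat.{u} R → Prop}
    (h : ∀ X, 𝒯 X → ∃ (Y : ModuleCat.{u} R) (j : X →ₗ[R] Y), 𝒴 Y ∧ Function.Injective j ∧
      Function.Surjective (LinearMap.lcomp R T j) ∧ 𝒯 (.of R (Y ⧸ LinearMap.range j)))
    (hM : 𝒯 (.of R M)) : ∃ S : Coresolution R M, (∀ n, 𝒴 (S.X n)) ∧ S.HomExact T := by
  choose Y j hY hj hjT hnext using h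
  let N : ℕ → {X // 𝒯 X} := Nat.rec ⟨_, hM⟩ fun _ X => ⟨_, hnext X.1 X.2⟩
  let ι (n : ℕ) : (N n).1 →ₗ[R] Y _ (N n).2 := j _ (N n).2
  let π (n : ℕ) : Y _ (N n).2 →ₗ[R] (N (n + 1)).1 := (LinearMap.range (ι n)).mkQ
  have hπ (n : ℕ) : Function.Surjective (π n) := Submodule.mkQ_surjective _
  have hιπ (n : ℕ) : Function.Exact (ι n) (π n) := (ι n).exact_map_mkQ_range
  have hex (n : ℕ) : Function.Exact (ι n) (ι (n + 1) ∘ₗ π n) :=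
    (hj _ (N (n + 1)).2).comp_exact_iff_exact.2 (hιπ n)
  have hexT (n : ℕ) : ContraHomExact T (ι n) (ι (n + 1) ∘ₗ π n) :=
    contraHomExact_comp_of_surjective_lcomp (hιπ n) (hπ n) (hjT _ (N (n + 1)).2)
  let S : Coresolution R M :=
    { X := fun n => Y _ (N n).2
      d := fun n => ι (n + 1) ∘ₗ π n
      coaug := ι 0
      injective_coaug := hj _ hM
      exact_coaug := hex 0
      exact := fun n => (hπ n).comp_exact_iff_exact.2 (hex (n + 1)) }
  exact ⟨S, fun n => hY _ (N n).2, hjT _ hM, hexT 0,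
    fun n => (contraHomExact_comp_iff (hπ n)).2 (hexT (n + 1))⟩

theorem IsStablyCoresolved.exists_coresolution_pi [Module.Finite R C] [Module.Finite R M]
    (hM : IsStablyCoresolved R C M) :
    ∃ S : Coresolution R M, (∀ n, ∃ k, Nonempty (S.X n ≃ₗ[R] (Fin k → C))) ∧ S.HomExact C := by
  refine exists_coresolution_of_exists_embedding
    (𝒯 := fun X => Module.Finite R X ∧ IsStablyCoresolved R C X)
    (𝒴 := fun Y => ∃ k, Nonempty (Y ≃ₗ[R] (Fin k → C))) ?_ ⟨‹_›, hM⟩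
  rintro X ⟨_, hX⟩
  obtain ⟨n, j, hj, hjC, hN⟩ := hX.exists_embedding_pi
  exact ⟨.of R (Fin n → C), j, ⟨n, ⟨LinearEquiv.refl R _⟩⟩, hj, hjC,
    inferInstanceAs (Module.Finite R ((Fin n → C) ⧸ LinearMap.range j)), hN⟩

theorem isInAdd_of_linearEquiv_pi {T : Type u} [AddCommGroup T] [Module R T] {n : ℕ}
    (e : M ≃ₗ[R] (Fin n → T)) : IsInAdd R T M :=
  ⟨n, ⊤, ⊥, isCompl_top_bot, ⟨e.trans Submodule.topEquiv.symm⟩⟩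

theorem isInAdd_dual_of_linearEquiv_pi (hC : Function.Bijective (LinearMap.lsmul R C)) {n : ℕ}
    (e : M ≃ₗ[R] (Fin n → C)) : IsInAdd R R (M →ₗ[R] C) :=
  isInAdd_of_linearEquiv_pi <| e.congrLeft C R ≪≫ₗ
    (LinearMap.lsum R (fun _ : Fin n => C) R).symm ≪≫ₗ
      LinearEquiv.piCongrRight fun _ => (LinearEquiv.ofBijective (LinearMap.lsmul R C) hC).symm

/-- The resolution of `Hom(M, N)` obtained by applying `Hom(-, N)` to a coresolution of `M`. -/
def Coresolution.dual {N : Type u} [AddCommGroup N] [Module R N] (S : Coresolution R M)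
    (hS : S.HomExact N) : Resolution R (M →ₗ[R] N) where
  X n := .of R (S.X n →ₗ[R] N)
  d n := LinearMap.lcomp R N (S.d n)
  aug := LinearMap.lcomp R N S.coaug
  exact := hS.exact
  exact_aug := hS.exact_coaug
  surjective_aug := hS.surjective_coaug

theorem Resolution.homExact_of_projective (S : Resolution R M) (P : Type u) [AddCommGroup P]
    [Module R P] [Module.Projective R P] : S.HomExact P where
  exact n := covHomExact_of_projective (S.exact n)
  exact_aug := covHomExact_of_projective S.exact_aug
  surjective_aug φ := Module.projective_lifting_property S.aug φ S.surjective_aug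

end FiniteCoresolution

theorem IsSemidualizing.finite {R : Type u} [CommRing R] {C : Type u} [AddCommGroup C]
    [Module R C] (hC : IsSemidualizing R C) : Module.Finite R C := by
  obtain ⟨S, hS⟩ := hC.resolution
  have := (hS 0).1
  exact Module.Finite.of_surjective S.aug S.surjective_aug

end RelGorenstein

theorem lemma3p1_general {R : Type u} [CommRing R] {C : Type u} [AddCommGroup C] [Module R C]
    [Module.Finite R C] (hC : Function.Bijective (LinearMap.lsmul R C))
    {M : Type u} [AddCommGroup M] [Module R M] [Module.Finite R M]
    (hM : RelGorenstein.IsStablyCoresolved R C M) :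
    RelGorenstein.IsInCogenStar R C M ∧
    (∃ S : RelGorenstein.Coresolution R M,
      (∃ α : ℕ → ℕ, ∀ n, Nonempty (S.X n ≃ₗ[R] (Fin (α n) → C))) ∧ S.HomExact C) ∧
    RelGorenstein.IsInGenStar R R (M →ₗ[R] C) := by
  obtain ⟨S, hSC, hS⟩ := hM.exists_coresolution_pi
  choose α hα using hSC
  exact ⟨⟨S, fun n => RelGorenstein.isInAdd_of_linearEquiv_pi (hα n).some, hS⟩, ⟨S, ⟨α, hα⟩, hS⟩,
    S.dual hS, fun n => RelGorenstein.isInAdd_dual_of_linearEquiv_pi hC (hα n).some,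
    (S.dual hS).homExact_of_projective R⟩

theorem lemma3p1 (R : Type u) [CommRing R]
    (C : Type u) [AddCommGroup C] [Module R C] (hC : RelGorenstein.IsSemidualizing R C)
    (M : Type u) [AddCommGroup M] [Module R M] [Module.Finite R M]
    (hM : RelGorenstein.IsGCProjective R C M) :
    RelGorenstein.IsInCogenStar R C M ∧
    (∃ S : RelGorenstein.Coresolution R M,
      (∃ α : ℕ → ℕ, ∀ n, Nonempty (S.X n ≃ₗ[R] (Fin (α n) → C))) ∧ S.HomExact C) ∧
    RelGorenstein.IsInGenStar R R (M →ₗ[R] C) := by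
  have := hC.finite
  exact lemma3p1_general hC.homothety hM.isStablyCoresolved
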